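/- Let $E$ be a real or complex Hilbert space, let $\tau$ be a Hausdorff topology on $E$, and let $C$ be a bounded closed convex subset of $E$ (bounded and closed in norm). Let $\{T(t) : t \ge 0\}$ be a one-parameter $\tau$-continuous semigroup of nonexpansive mappings on $C$, that is, a family of mappings $T(t) : C \to C$ such that 1. $T(s+t) = T(s) \circ T(t)$ for all $s, t \ge 0$; 2. for each $x \in C$, the mapping $t \mapsto T(t)x$ from $[0,\infty)$ into $C$ is continuous with respect to $\tau$; 3. $\|T(t)x - T(t)y\| \le \|x - y\|$ for all $t \ge 0$ and $x, y \in C$. ($T(0)$ need not be the identity.) Let $\alpha, \beta > 0$ with $\alpha/\beta \notin \mathbb{Q}$. Let $x \in C$ and define $$x_n = \frac{1}{n^2} \sum_{k=1}^n \sum_{\ell=1}^n T(k\alpha + \ell\beta)\,x \qquad (n = 1, 2, 3, \dots).$$ Then $\{x_n\}$ converges weakly to a common fixed point of $\{T(t) : t \ge 0\}$, i.e. there is $z \in C$ with $T(t)z = z$ for all $t \ge 0$ such that $x_n \to z$ in the weak topology of $E$. -/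

import Mathlib

open Filter Topology
open scoped NNReal

/-- `{T(t) : t ≥ 0}` is a one-parameter `τ`-continuous semigroup of nonexpansive mappings on the
subset `C` of the normed space `E`. The topology `τ` on `E` need not be the norm topology, and
`T(0)` is not required to be the identity. -/
structure IsNonexpansiveSemigroup {E : Type*} [NormedAddCommGroup E]
    (τ : TopologicalSpace E) (C : Set E) (T : ℝ≥0 → C → C) : Prop where
  comp : ∀ s t : ℝ≥0, T (s + t) = T s ∘ T t
  continuous_orbit : ∀ x : C, @Continuous ℝ≥0 E inferInstance τ (fun t => (T t x : E))
  nonexpansive : ∀ (t : ℝ≥0) (x y : C), ‖(T t x : E) - (T t y : E)‖ ≤ ‖(x : E) - (y : E)‖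

/-- Weak convergence of a sequence in a normed space over `𝕜`: convergence in the weak topology,
the one induced by the norm-continuous `𝕜`-linear functionals. -/
def WeaklyConvergesTo (𝕜 : Type*) [RCLike 𝕜] {E : Type*} [NormedAddCommGroup E] [NormedSpace 𝕜 E]
    (u : ℕ → E) (z : E) : Prop :=
  Tendsto (fun n => toWeakSpace 𝕜 E (u n)) atTop (𝓝 (toWeakSpace 𝕜 E z))

/-!
The double orbit `a k l = T (k α + l β) x` is advanced by the nonexpansive map `T α` in its first
index and by `T β` in its second, so the convergence of the square means `x_n` is a mean ergodic
theorem for two nonexpansive maps (`exists_weaklyConvergesTo_squareMean`). Since `C` is weakly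
compact, it is enough that weak cluster points of `x_n` are common fixed points of the two maps and
that there is only one of them.

* Fixed points (`apply_eq_of_tendsto_squareMean`): if `x_n → z` weakly along a filter, expand
  `‖a (k + 1) l - S z‖² ≤ ‖a k l - z‖²` around `S z`, where `S = T α`, and average over the square.
  The terms `‖a k l - S z‖² - ‖a (k + 1) l - S z‖²` telescope to `O(1 / n)`, the rest is affine in
  `x_n`, and the limit is `‖S z - z‖² ≤ 0`.
* Uniqueness (`eq_of_tendsto_squareMean`): for a common fixed point `p` the double sequence
  `‖a k l - p‖²` is nonincreasing in `k` and in `l`, so its square means converge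
  (`exists_tendsto_squareMean_of_antitone`). For two common fixed points `p` and `q` the difference
  of these double sequences is affine in `a k l`, so `re ⟪q - p, x_n⟫` converges; if both are weak
  cluster points, then `re ⟪q - p, p⟫ = re ⟪q - p, q⟫`, that is, `p = q`.

A common fixed point `z` of `T α` and `T β` is fixed by every `T t`
(`IsNonexpansiveSemigroup.apply_eq_of_irrational`): the orbit `t ↦ T t z` is continuous into a
Hausdorff space and has the incommensurable periods `α` and `β`, hence is constant.
-/

/-! ### Two incommensurable periods -/

section Periods

/-- A continuous function on `[0, ∞)` with values in a Hausdorff space and with two incommensurable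
periods is constant. -/
theorem NNReal.eq_apply_zero_of_irrational_periods {X : Type*} [TopologicalSpace X] [T2Space X]
    {f : ℝ≥0 → X} (hf : Continuous f) {α β : ℝ≥0} (hα : ∀ t, f (t + α) = f t)
    (hβ : ∀ t, f (t + β) = f t) (hαβ : Irrational ((α : ℝ) / (β : ℝ))) (t : ℝ≥0) :
    f t = f 0 := by
  have hmul {γ : ℝ≥0} (hγ : ∀ t, f (t + γ) = f t) (n : ℕ) (t : ℝ≥0) : f (t + n * γ) = f t := by
    induction n with
    | zero => simp
    | succ n ih => rw [Nat.cast_succ, add_mul, one_mul, ← add_assoc, hγ, ih]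
  -- Negative reals are sent to `0` by `Real.toNNReal`, so only nonnegative `m α + n β` matter.
  have hclosed : IsClosed {s : ℝ | f s.toNNReal = f 0} :=
    isClosed_eq (hf.comp continuous_real_toNNReal) continuous_const
  have hsub : (AddSubgroup.closure {(α : ℝ), (β : ℝ)} : Set ℝ) ⊆ {s : ℝ | f s.toNNReal = f 0} := by
    intro s hs
    obtain ⟨m, n, hmn⟩ := AddSubgroup.mem_closure_pair.1 hs
    rw [Set.mem_ofPred_eq]
    rcases le_total s 0 with h0 | h0
    · rw [Real.toNNReal_of_nonpos h0]
    -- Translating by `|m| α + |n| β` makes both coefficients natural numbers.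
    have key : s.toNNReal + m.natAbs * α + n.natAbs * β
        = 0 + (m + m.natAbs).toNat * α + (n + n.natAbs).toNat * β := by
      have h1 : (((m + m.natAbs).toNat : ℤ) : ℝ) = ((m + m.natAbs : ℤ) : ℝ) := by
        congr 1; omega
      have h2 : (((n + n.natAbs).toNat : ℤ) : ℝ) = ((n + n.natAbs : ℤ) : ℝ) := by
        congr 1; omega
      rw [Int.cast_natCast, Int.cast_add, Int.cast_natCast] at h1 h2
      apply NNReal.coe_injective
      simp only [NNReal.coe_add, NNReal.coe_mul, NNReal.coe_natCast, NNReal.coe_zero,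
        Real.coe_toNNReal _ h0, h1, h2]
      simp only [← hmn, zsmul_eq_mul]
      ring
    have := congrArg f key
    rwa [hmul hβ, hmul hα, hmul hβ, hmul hα] at this
  have := (hclosed.closure_subset_iff.2 hsub) (dense_addSubgroupClosure_pair_iff.2 hαβ (t : ℝ))
  simpa using this

end Periods

/-! ### Weak compactness in Hilbert spaces -/

section WeakTopology

variable {𝕜 : Type*} [RCLike 𝕜] {E : Type*} [NormedAddCommGroup E] [InnerProductSpace 𝕜 E]
  [CompleteSpace E]

theorem tendsto_toWeakSpace_iff_forall_inner {ι : Type*} {l : Filter ι} {u : ι → E} {z : E} :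
    Tendsto (fun i => toWeakSpace 𝕜 E (u i)) l (𝓝 (toWeakSpace 𝕜 E z)) ↔
      ∀ y : E, Tendsto (fun i => inner 𝕜 y (u i)) l (𝓝 (inner 𝕜 y z)) := by
  have hinj : Function.Injective (topDualPairing 𝕜 E).flip := fun v w h =>
    ext_inner_left 𝕜 fun y => by
      simpa using LinearMap.congr_fun h (InnerProductSpace.toDual 𝕜 E y)
  refine (WeakBilin.tendsto_iff_forall_eval_tendsto _ hinj).trans ⟨fun h y => ?_, fun h f => ?_⟩
  · exact h (InnerProductSpace.toDual 𝕜 E y)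
  · obtain ⟨y, rfl⟩ := (InnerProductSpace.toDual 𝕜 E).surjective f
    exact h y

variable (𝕜) in
/-- Bounded sets of a Hilbert space lie in weakly compact balls: the Riesz isomorphism carries the
weak-* topology of the dual to the weak topology. -/
theorem isCompact_toWeakSpace_image_closedBall (r : ℝ) :
    IsCompact (toWeakSpace 𝕜 E '' Metric.closedBall 0 r) := by
  let Φ : WeakDual 𝕜 E → WeakSpace 𝕜 E := fun φ =>
    toWeakSpace 𝕜 E ((InnerProductSpace.toDual 𝕜 E).symm (WeakDual.toStrongDual φ))
  have hΦ : Continuous Φ := by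
    refine continuous_iff_continuousAt.2 fun φ => tendsto_toWeakSpace_iff_forall_inner.2 fun y => ?_
    simp_rw [← inner_conj_symm y, InnerProductSpace.toDual_symm_apply]
    exact (RCLike.continuous_conj.comp (WeakDual.eval_continuous y)).tendsto φ
  convert (WeakDual.isCompact_closedBall (𝕜 := 𝕜) (E := E) 0 r).image hΦ using 1
  ext v
  constructor
  · rintro ⟨w, hw, rfl⟩
    refine ⟨StrongDual.toWeakDual (InnerProductSpace.toDual 𝕜 E w), ?_, ?_⟩
    · simpa using hw
    · simp [Φ]
  · rintro ⟨φ, hφ, rfl⟩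
    exact ⟨_, by simpa using hφ, rfl⟩

theorem isCompact_toWeakSpace_image [NormedSpace ℝ E] [IsScalarTower ℝ 𝕜 E] {C : Set E}
    (hbdd : Bornology.IsBounded C) (hclosed : IsClosed C) (hconv : Convex ℝ C) :
    IsCompact (toWeakSpace 𝕜 E '' C) := by
  obtain ⟨r, hr⟩ := hbdd.subset_closedBall 0
  refine (isCompact_toWeakSpace_image_closedBall 𝕜 r).of_isClosed_subset ?_ (Set.image_mono hr)
  have h := hconv.toWeakSpace_closure 𝕜
  rw [hclosed.closure_eq] at h
  exact h ▸ isClosed_closure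

end WeakTopology

/-! ### Cesàro means over squares -/

section SquareMean

variable {F : Type*} [AddCommGroup F] [Module ℝ F]

/-- The Cesàro mean of the double sequence `f` over the square `{1, …, n} × {1, …, n}`; it is `0`
for `n = 0`. -/
noncomputable def squareMean (f : ℕ → ℕ → F) (n : ℕ) : F :=
  ((n : ℝ) ^ 2)⁻¹ • ∑ k ∈ Finset.Icc 1 n, ∑ l ∈ Finset.Icc 1 n, f k l

theorem squareMean_swap (f : ℕ → ℕ → F) : squareMean (fun k l => f l k) = squareMean f := by
  funext n
  rw [squareMean, squareMean, Finset.sum_comm]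

theorem squareMean_add (f g : ℕ → ℕ → F) (n : ℕ) :
    squareMean (fun k l => f k l + g k l) n = squareMean f n + squareMean g n := by
  simp only [squareMean, Finset.sum_add_distrib, smul_add]

theorem squareMean_const (c : F) {n : ℕ} (hn : n ≠ 0) : squareMean (fun _ _ => c) n = c := by
  have h : (n : ℝ) ≠ 0 := Nat.cast_ne_zero.2 hn
  simp only [squareMean, Finset.sum_const, Nat.card_Icc, Nat.add_sub_cancel,
    ← Nat.cast_smul_eq_nsmul ℝ, smul_smul]
  rw [← sq, inv_mul_cancel₀ (pow_ne_zero 2 h), one_smul]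

theorem LinearMap.map_squareMean {G : Type*} [AddCommGroup G] [Module ℝ G] (L : F →ₗ[ℝ] G)
    (f : ℕ → ℕ → F) (n : ℕ) : L (squareMean f n) = squareMean (fun k l => L (f k l)) n := by
  simp only [squareMean, map_smul, map_sum]

theorem squareMean_mono {f g : ℕ → ℕ → ℝ} (h : ∀ k l, f k l ≤ g k l) (n : ℕ) :
    squareMean f n ≤ squareMean g n := by
  unfold squareMean
  gcongr
  exact h _ _

theorem Convex.squareMean_mem {C : Set F} (hC : Convex ℝ C) {f : ℕ → ℕ → F}
    (hf : ∀ k l, f k l ∈ C) {n : ℕ} (hn : n ≠ 0) : squareMean f n ∈ C := by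
  have h : (n : ℝ) ≠ 0 := Nat.cast_ne_zero.2 hn
  rw [squareMean, ← Finset.sum_product', Finset.smul_sum]
  refine hC.sum_mem (fun _ _ => by positivity) ?_ fun _ _ => hf _ _
  simp only [Finset.sum_const, Finset.card_product, Nat.card_Icc, Nat.add_sub_cancel, nsmul_eq_mul,
    Nat.cast_mul]
  field_simp

/-- The mean of the differences of a bounded double sequence in one variable telescopes to a
boundary term of order `1 / n`. -/
theorem tendsto_squareMean_sub_succ {b : ℕ → ℕ → ℝ} {M : ℝ} (hb : ∀ k l, |b k l| ≤ M) :
    Tendsto (squareMean fun k l => b k l - b (k + 1) l) atTop (𝓝 0) := by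
  have hlim : Tendsto (fun n : ℕ => 2 * M * (n : ℝ)⁻¹) atTop (𝓝 0) := by
    simpa using tendsto_inv_atTop_nhds_zero_nat (𝕜 := ℝ) |>.const_mul (2 * M)
  refine squeeze_zero_norm (fun n => ?_) hlim
  rcases eq_or_ne n 0 with rfl | hn
  · simp [squareMean]
  have h : (0 : ℝ) < n := by positivity
  have htel (l : ℕ) : ∑ k ∈ Finset.Icc 1 n, (b k l - b (k + 1) l) = b 1 l - b (n + 1) l := by
    rw [← neg_inj, ← Finset.sum_neg_distrib]
    simpa [Finset.range_eq_Ico, ← Finset.Ico_add_one_right_eq_Icc] using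
      Finset.sum_Ico_sub (fun k => b k l) (show 1 ≤ n + 1 by omega)
  rw [squareMean, Finset.sum_comm, norm_smul, norm_inv, norm_pow, Real.norm_natCast]
  simp only [htel]
  calc ((n : ℝ) ^ 2)⁻¹ * ‖∑ l ∈ Finset.Icc 1 n, (b 1 l - b (n + 1) l)‖
      ≤ ((n : ℝ) ^ 2)⁻¹ * ∑ l ∈ Finset.Icc 1 n, (2 * M) := by
        gcongr
        refine norm_sum_le_of_le _ fun l _ => ?_
        rw [Real.norm_eq_abs]
        linarith [abs_sub (b 1 l) (b (n + 1) l), hb 1 l, hb (n + 1) l]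
    _ = 2 * M * (n : ℝ)⁻¹ := by
        simp only [Finset.sum_const, Nat.card_Icc, Nat.add_sub_cancel, nsmul_eq_mul]
        field_simp

/-- A double sequence that is nonincreasing in each variable and bounded below has convergent square
means: it lies between `L` and `L + g k + g l`, where `L` is the limit along the diagonal and
`g k = b k k - L`. -/
theorem exists_tendsto_squareMean_of_antitone {b : ℕ → ℕ → ℝ} (h₁ : ∀ k l, b (k + 1) l ≤ b k l)
    (h₂ : ∀ k l, b k (l + 1) ≤ b k l) (h₀ : ∀ k l, 0 ≤ b k l) :
    ∃ L, Tendsto (squareMean b) atTop (𝓝 L) := by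
  have hb {k k' l l' : ℕ} (hk : k ≤ k') (hl : l ≤ l') : b k' l' ≤ b k l :=
    (antitone_nat_of_succ_le (f := fun i => b i l') (fun i => h₁ i l') hk).trans
      (antitone_nat_of_succ_le (f := fun i => b k i) (fun i => h₂ k i) hl)
  have hdiag : Antitone fun k => b k k := fun _ _ h => hb h h
  have hbdd : BddBelow (Set.range fun k => b k k) := ⟨0, by rintro _ ⟨k, rfl⟩; exact h₀ k k⟩
  set L := ⨅ k, b k k
  have hL : Tendsto (fun k => b k k) atTop (𝓝 L) := tendsto_atTop_ciInf hdiag hbdd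
  have hLle (k : ℕ) : L ≤ b k k := ciInf_le hbdd k
  refine ⟨L, ?_⟩
  have hg : Tendsto (fun k => b (k + 1) (k + 1) - L) atTop (𝓝 0) := by
    simpa using (hL.comp (tendsto_add_atTop_nat 1)).sub_const L
  have hmean (n : ℕ) : squareMean (fun k _ => b k k - L) n
      = (n : ℝ)⁻¹ * ∑ i ∈ Finset.range n, (b (i + 1) (i + 1) - L) := by
    rw [squareMean, Finset.range_eq_Ico, Finset.sum_Ico_add' (fun i => b i i - L) 0 n 1,
      zero_add, Finset.Ico_add_one_right_eq_Icc]
    simp only [Finset.sum_const, Nat.card_Icc, Nat.add_sub_cancel, nsmul_eq_mul, smul_eq_mul]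
    rw [← Finset.mul_sum, ← mul_assoc]
    congr 1
    rcases eq_or_ne n 0 with rfl | hn
    · simp
    · field_simp
  have hzero : Tendsto (squareMean fun k _ => b k k - L) atTop (𝓝 0) := by
    simpa only [← hmean] using hg.cesaro
  have hzero' : Tendsto (squareMean fun _ l => b l l - L) atTop (𝓝 0) := by
    rwa [squareMean_swap fun k _ => b k k - L]
  have hupper : Tendsto (fun n => L + (squareMean (fun k _ => b k k - L) n
      + squareMean (fun _ l => b l l - L) n)) atTop (𝓝 L) := by
    simpa using (hzero.add hzero').const_add L
  refine tendsto_of_tendsto_of_tendsto_of_le_of_le' tendsto_const_nhds hupper ?_ ?_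
  · filter_upwards [eventually_ne_atTop 0] with n hn
    rw [← squareMean_const L hn]
    exact squareMean_mono
      (fun k l => (hLle (max k l)).trans (hb (le_max_left k l) (le_max_right k l))) n
  · filter_upwards [eventually_ne_atTop 0] with n hn
    have hsum := squareMean_add (fun _ _ => L) (fun k l => (b k k - L) + (b l l - L)) n
    rw [squareMean_const L hn, squareMean_add (fun k _ => b k k - L)] at hsum
    rw [← hsum]
    refine squareMean_mono (fun k l => ?_) n
    rcases le_total k l with h | h
    · linarith [hb (le_refl k) h, hLle l]
    · linarith [hb h (le_refl l), hLle k]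

end SquareMean

/-! ### The mean ergodic theorem for two nonexpansive maps -/

section Ergodic

variable {𝕜 : Type*} [RCLike 𝕜] {E : Type*} [NormedAddCommGroup E] [InnerProductSpace 𝕜 E]
  [NormedSpace ℝ E] [IsScalarTower ℝ 𝕜 E]

variable (𝕜) in
theorem re_inner_squareMean (y : E) (a : ℕ → ℕ → E) (n : ℕ) :
    RCLike.re (inner 𝕜 y (squareMean a n))
      = squareMean (fun k l => RCLike.re (inner 𝕜 y (a k l))) n := by
  let L : E →ₗ[ℝ] ℝ :=
    { toFun := fun v => RCLike.re (inner 𝕜 y v)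
      map_add' := fun v w => by simp [inner_add_right]
      map_smul' := fun r v => by simp [inner_smul_right_eq_smul, RCLike.smul_re] }
  exact L.map_squareMean a n

/-- Weak limits of square means, along any filter finer than `atTop`, are fixed by a nonexpansive
map `S` that advances the double sequence in its first index. Averaging
`‖a (k + 1) l - S z‖² ≤ ‖a k l - z‖²` leaves `‖S z - z‖² ≤ 0` in the limit. -/
theorem apply_eq_of_tendsto_squareMean {C : Set E} (hC : Bornology.IsBounded C) {S : C → C}
    (hS : ∀ x y : C, ‖(S x : E) - S y‖ ≤ ‖(x : E) - y‖) {a : ℕ → ℕ → C}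
    (ha : ∀ k l, a (k + 1) l = S (a k l)) {𝓕 : Filter ℕ} [𝓕.NeBot] (h𝓕 : 𝓕 ≤ atTop) {z : C}
    (hz : ∀ y : E, Tendsto (fun n => inner 𝕜 y (squareMean (fun k l => (a k l : E)) n)) 𝓕
      (𝓝 (inner 𝕜 y (z : E)))) :
    S z = z := by
  obtain ⟨M, hM⟩ := Metric.isBounded_iff.1 hC
  set w : E := S z - z with hw
  set b : ℕ → ℕ → ℝ := fun k l => ‖(a k l : E) - S z‖ ^ 2 with hbdef
  have hb (k l : ℕ) : |b k l| ≤ M ^ 2 := by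
    have h := hM (a k l).2 (S z).2
    rw [dist_eq_norm] at h
    rw [abs_of_nonneg (by positivity)]
    exact pow_le_pow_left₀ (norm_nonneg _) h 2
  have hpt (k l : ℕ) : (2 * RCLike.re (inner 𝕜 w (S z : E)) - ‖w‖ ^ 2)
      + RCLike.re (inner 𝕜 (-(2 : 𝕜) • w) (a k l : E)) ≤ b k l - b (k + 1) l := by
    have h1 : b (k + 1) l ≤ ‖(a k l : E) - z‖ ^ 2 := by
      simp only [hbdef, ha]
      exact pow_le_pow_left₀ (norm_nonneg _) (hS _ _) 2
    have h2 : (a k l : E) - z = ((a k l : E) - S z) + w := by rw [hw]; abel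
    rw [h2, norm_add_sq (𝕜 := 𝕜), ← inner_conj_symm, RCLike.conj_re, inner_sub_right, map_sub] at h1
    have h3 : RCLike.re (inner 𝕜 (-(2 : 𝕜) • w) (a k l : E))
        = -2 * RCLike.re (inner 𝕜 w (a k l : E)) := by
      rw [inner_smul_left]; simp [RCLike.mul_re]
    rw [h3]
    simp only [hbdef] at h1 ⊢
    linarith
  have hlim : Tendsto (fun n => (2 * RCLike.re (inner 𝕜 w (S z : E)) - ‖w‖ ^ 2)
      + RCLike.re (inner 𝕜 (-(2 : 𝕜) • w) (squareMean (fun k l => (a k l : E)) n))) 𝓕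
      (𝓝 ((2 * RCLike.re (inner 𝕜 w (S z : E)) - ‖w‖ ^ 2)
        + RCLike.re (inner 𝕜 (-(2 : 𝕜) • w) (z : E)))) :=
    ((RCLike.continuous_re.tendsto _).comp (hz _)).const_add _
  have hle := le_of_tendsto_of_tendsto hlim ((tendsto_squareMean_sub_succ hb).mono_left h𝓕) <| by
    filter_upwards [h𝓕 (eventually_ne_atTop 0)] with n hn
    rw [re_inner_squareMean]
    nth_rw 1 [← squareMean_const (2 * RCLike.re (inner 𝕜 w (S z : E)) - ‖w‖ ^ 2) hn]
    rw [← squareMean_add]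
    exact squareMean_mono hpt n
  have h3 : RCLike.re (inner 𝕜 (-(2 : 𝕜) • w) (z : E)) = -2 * RCLike.re (inner 𝕜 w (z : E)) := by
    rw [inner_smul_left]; simp [RCLike.mul_re]
  have h4 : RCLike.re (inner 𝕜 w (S z : E)) - RCLike.re (inner 𝕜 w (z : E)) = ‖w‖ ^ 2 := by
    rw [← map_sub, ← inner_sub_right, ← hw, inner_self_eq_norm_sq]
  have h5 : ‖w‖ ^ 2 ≤ 0 := by rw [h3] at hle; linarith
  have h6 : w = 0 := by
    rw [← norm_eq_zero]; exact pow_eq_zero_iff two_ne_zero |>.1 (le_antisymm h5 (by positivity))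
  exact Subtype.ext (sub_eq_zero.1 h6)

/-- If the square means of `‖a k l - p‖²` and of `‖a k l - q‖²` converge, then `p` and `q` cannot
be distinct weak cluster points of the square means of `a`: the difference
`‖a k l - p‖² - ‖a k l - q‖²` is affine in `a k l`, with linear part `2 re ⟪q - p, a k l⟫`. -/
theorem eq_of_tendsto_squareMean {a : ℕ → ℕ → E} {p q : E} {Lp Lq : ℝ}
    (hp : Tendsto (squareMean fun k l => ‖a k l - p‖ ^ 2) atTop (𝓝 Lp))
    (hq : Tendsto (squareMean fun k l => ‖a k l - q‖ ^ 2) atTop (𝓝 Lq))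
    {𝓕 𝓖 : Filter ℕ} [𝓕.NeBot] [𝓖.NeBot] (h𝓕 : 𝓕 ≤ atTop) (h𝓖 : 𝓖 ≤ atTop)
    (hap : ∀ y : E, Tendsto (fun n => inner 𝕜 y (squareMean a n)) 𝓕 (𝓝 (inner 𝕜 y p)))
    (haq : ∀ y : E, Tendsto (fun n => inner 𝕜 y (squareMean a n)) 𝓖 (𝓝 (inner 𝕜 y q))) :
    p = q := by
  set v : E := (2 : 𝕜) • (q - p) with hv
  have hre (x : E) : RCLike.re (inner 𝕜 v x) = 2 * RCLike.re (inner 𝕜 (q - p) x) := by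
    rw [hv, inner_smul_left]; simp [RCLike.mul_re]
  have hpt (k l : ℕ) : ‖a k l - p‖ ^ 2
      = ‖a k l - q‖ ^ 2 + (RCLike.re (inner 𝕜 v (a k l)) + (‖p‖ ^ 2 - ‖q‖ ^ 2)) := by
    rw [hre, norm_sub_sq (𝕜 := 𝕜), norm_sub_sq (𝕜 := 𝕜), inner_sub_left, map_sub,
      inner_re_symm p, inner_re_symm q]
    ring
  have hconv : Tendsto (fun n => RCLike.re (inner 𝕜 v (squareMean a n))) atTop
      (𝓝 (Lp - Lq - (‖p‖ ^ 2 - ‖q‖ ^ 2))) := by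
    refine ((hp.sub hq).sub_const (‖p‖ ^ 2 - ‖q‖ ^ 2)).congr' ?_
    filter_upwards [eventually_ne_atTop 0] with n hn
    simp only [hpt]
    rw [squareMean_add, squareMean_add, squareMean_const _ hn, re_inner_squareMean]
    ring
  have hvp := tendsto_nhds_unique ((RCLike.continuous_re.tendsto _).comp (hap v))
    (hconv.mono_left h𝓕)
  have hvq := tendsto_nhds_unique ((RCLike.continuous_re.tendsto _).comp (haq v))
    (hconv.mono_left h𝓖)
  have h : RCLike.re (inner 𝕜 (q - p) (q - p)) = 0 := by
    rw [inner_sub_right, map_sub]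
    linarith [hre p, hre q]
  rw [inner_self_eq_norm_sq, sq_eq_zero_iff, norm_eq_zero] at h
  exact (sub_eq_zero.1 h).symm

/-- **Mean ergodic theorem for two nonexpansive maps.** The square means of a double orbit of two
nonexpansive self-maps of a bounded closed convex set of a Hilbert space converge weakly to a common
fixed point. -/
theorem exists_weaklyConvergesTo_squareMean [CompleteSpace E] {C : Set E}
    (hbdd : Bornology.IsBounded C) (hclosed : IsClosed C) (hconv : Convex ℝ C) {S R : C → C}
    (hS : ∀ x y : C, ‖(S x : E) - S y‖ ≤ ‖(x : E) - y‖)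
    (hR : ∀ x y : C, ‖(R x : E) - R y‖ ≤ ‖(x : E) - y‖) {a : ℕ → ℕ → C}
    (haS : ∀ k l, a (k + 1) l = S (a k l)) (haR : ∀ k l, a k (l + 1) = R (a k l)) :
    ∃ z : C, S z = z ∧ R z = z ∧
      WeaklyConvergesTo 𝕜 (squareMean fun k l => (a k l : E)) (z : E) := by
  set x : ℕ → E := squareMean fun k l => (a k l : E) with hx
  have hcluster (𝓤 : Ultrafilter ℕ) (h𝓤 : ↑𝓤 ≤ (atTop : Filter ℕ)) :
      ∃ z : C, ∀ y : E, Tendsto (fun n => inner 𝕜 y (x n)) 𝓤 (𝓝 (inner 𝕜 y (z : E))) := by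
    have hmem : ↑(𝓤.map fun n => toWeakSpace 𝕜 E (x n)) ≤ 𝓟 (toWeakSpace 𝕜 E '' C) := by
      rw [le_principal_iff, Ultrafilter.mem_coe, Ultrafilter.mem_map, ← Ultrafilter.mem_coe]
      filter_upwards [h𝓤 (Ioi_mem_atTop 0)] with n hn
      exact ⟨_, hconv.squareMean_mem (fun k l => (a k l).2) (ne_of_gt hn), rfl⟩
    obtain ⟨_, ⟨z, hz, rfl⟩, hlim⟩ :=
      (isCompact_toWeakSpace_image (𝕜 := 𝕜) hbdd hclosed hconv).ultrafilter_le_nhds _ hmem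
    exact ⟨⟨z, hz⟩, tendsto_toWeakSpace_iff_forall_inner.1 hlim⟩
  have hfix {𝓤 : Ultrafilter ℕ} (h𝓤 : ↑𝓤 ≤ (atTop : Filter ℕ)) {z : C}
      (hz : ∀ y : E, Tendsto (fun n => inner 𝕜 y (x n)) 𝓤 (𝓝 (inner 𝕜 y (z : E)))) :
      S z = z ∧ R z = z := by
    refine ⟨apply_eq_of_tendsto_squareMean (𝕜 := 𝕜) hbdd hS haS h𝓤 hz,
      apply_eq_of_tendsto_squareMean (𝕜 := 𝕜) (a := fun k l => a l k) hbdd hR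
        (fun k l => haR l k) h𝓤 ?_⟩
    rwa [squareMean_swap fun k l => (a k l : E)]
  have hdist {p : C} (hp : S p = p ∧ R p = p) :
      ∃ L, Tendsto (squareMean fun k l => ‖(a k l : E) - p‖ ^ 2) atTop (𝓝 L) := by
    refine exists_tendsto_squareMean_of_antitone (fun k l => ?_) (fun k l => ?_)
      fun k l => by positivity
    · have := hS (a k l) p
      rw [hp.1, ← haS] at this
      gcongr
    · have := hR (a k l) p
      rw [hp.2, ← haR] at this
      gcongr
  obtain ⟨z, hz⟩ := hcluster (Ultrafilter.of atTop) (Ultrafilter.of_le atTop)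
  have hzfix := hfix (Ultrafilter.of_le atTop) hz
  refine ⟨z, hzfix.1, hzfix.2, (tendsto_iff_ultrafilter _ _ _).2 fun 𝓤 h𝓤 => ?_⟩
  obtain ⟨w, hw⟩ := hcluster 𝓤 h𝓤
  obtain ⟨_, hLz⟩ := hdist hzfix
  obtain ⟨_, hLw⟩ := hdist (hfix h𝓤 hw)
  rw [eq_of_tendsto_squareMean (𝕜 := 𝕜) hLz hLw (Ultrafilter.of_le atTop) h𝓤 hz hw]
  exact tendsto_toWeakSpace_iff_forall_inner.2 hw

end Ergodic

/-! ### Common fixed points of the semigroup -/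

/-- A common fixed point of `T α` and `T β` is fixed by the whole semigroup: its orbit has the
incommensurable periods `α` and `β`. -/
theorem IsNonexpansiveSemigroup.apply_eq_of_irrational {E : Type*} [NormedAddCommGroup E]
    {τ : TopologicalSpace E} (hτ : @T2Space E τ) {C : Set E} {T : ℝ≥0 → C → C}
    (hT : IsNonexpansiveSemigroup τ C T) {α β : ℝ≥0} (hαβ : Irrational ((α : ℝ) / (β : ℝ)))
    {z : C} (hα : T α z = z) (hβ : T β z = z) (t : ℝ≥0) : T t z = z := by
  have hconst := @NNReal.eq_apply_zero_of_irrational_periods E τ hτ _ (hT.continuous_orbit z) α β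
    (fun t => by rw [hT.comp, Function.comp_apply, hα])
    (fun t => by rw [hT.comp, Function.comp_apply, hβ]) hαβ
  exact Subtype.ext (((hconst t).trans (hconst α).symm).trans (congrArg _ hα))

theorem theorem5p1 {𝕜 : Type*} [RCLike 𝕜] {E : Type*} [NormedAddCommGroup E]
    [InnerProductSpace 𝕜 E] [NormedSpace ℝ E] [IsScalarTower ℝ 𝕜 E] [CompleteSpace E]
    (C : Set E) (hC_bdd : Bornology.IsBounded C) (hC_closed : IsClosed C) (hC_conv : Convex ℝ C)
    (τ : TopologicalSpace E) (hτ : @T2Space E τ)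
    (T : ℝ≥0 → C → C) (hT : IsNonexpansiveSemigroup τ C T)
    (α β : ℝ≥0) (hα : 0 < α) (hβ : 0 < β) (hαβ : Irrational ((α : ℝ) / (β : ℝ)))
    (x : C) :
    ∃ z : C, (∀ t : ℝ≥0, T t z = z) ∧
      WeaklyConvergesTo 𝕜
        (fun n : ℕ => ((n : ℝ) ^ 2)⁻¹ •
          ∑ k ∈ Finset.Icc 1 n, ∑ l ∈ Finset.Icc 1 n,
            (T ((k : ℝ≥0) * α + (l : ℝ≥0) * β) x : E))
        (z : E) := by
  obtain ⟨z, hzα, hzβ, hlim⟩ := exists_weaklyConvergesTo_squareMean (𝕜 := 𝕜) hC_bdd hC_closed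
    hC_conv (hT.nonexpansive α) (hT.nonexpansive β)
    (a := fun k l : ℕ => T ((k : ℝ≥0) * α + (l : ℝ≥0) * β) x)
    (fun k l => by
      rw [← Function.comp_apply (f := T α), ← hT.comp]
      congr 1
      push_cast
      ring)
    (fun k l => by
      rw [← Function.comp_apply (f := T β), ← hT.comp]
      congr 1
      push_cast
      ring)
  exact ⟨z, fun t => hT.apply_eq_of_irrational hτ hαβ hzα hzβ t, hlim⟩
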